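/- Let $\mathbb T=\mathbb R\cup\{-\infty\}\cup\mathbb R^{\nu}$ be the extended tropical semiring, where $\mathbb R^\nu=\{a^\nu: a\in\mathbb R\}$ is a second ("ghost") copy of $\mathbb R$. It is totally ordered by: $-\infty$ is the least element; for real $a<b$, both $a$ and $a^\nu$ precede both $b$ and $b^\nu$; and $a\prec a^\nu$. Addition is $x\oplus y=\max_\prec\{x,y\}$ for $x\ne y$, $a\oplus a=a^\nu\oplus a^\nu=a^\nu$ and $-\infty\oplus-\infty=-\infty$. Multiplication is $a b=a+b$, $a^\nu b=a b^\nu=a^\nu b^\nu=(a+b)^\nu$ (the sums $a+b$ being sums of real numbers), with $-\infty$ absorbing. Put $\bar{\mathbb U}=\mathbb R^\nu\cup\{-\infty\}$ and $\bar{\mathbb R}=\mathbb R\cup\{-\infty\}$. An $n\times n$ matrix $A=(a_{i,j})$ over $\mathbb T$ is called singular if its tropical determinant $|A|=\bigoplus_{\sigma\in S_n}a_{1,\sigma(1)}\cdots a_{n,\sigma(n)}$ lies in $\bar{\mathbb U}$. Theorem. Let $n\ge 1$, and let $S$ be a system of $n$ homogeneous linear equations in $n$ unknowns, given by polynomials $f_i=a_{i,1}\lambda_1\oplus\cdots\oplus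 a_{i,n}\lambda_n$ $(i=1,\dots,n)$ with $a_{i,j}\in\mathbb T$, and with coefficient matrix $A_S=(a_{i,j})$. A solution of $S$ is a point $\mathbf x\in\mathbb T^{n}$ with $f_i(\mathbf x)\in\bar{\mathbb U}$ for all $i$; it is pure real if $\mathbf x\in\mathbb R^{n}$. Then: 1. $S$ has a solution in $\bar{\mathbb R}^{n}$ other than $(-\infty,\dots,-\infty)$ if and only if $A_S$ is singular. 2. If $S$ has a pure real solution, then $A_S$ is singular. 3. If none of the coefficients $a_{i,j}$ is $-\infty$, then $S$ has a pure real solution if and only if $A_S$ is singular. -/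

import Mathlib

noncomputable section

/-- The underlying set of the extended tropical semiring: the element `-∞`, a copy of `ℝ`
(the real part) and a second, ghost copy of `ℝ` (the elements `a^ν`). -/
inductive ExtTrop : Type where
  | negInf : ExtTrop
  | real (a : ℝ) : ExtTrop
  | ghost (a : ℝ) : ExtTrop

namespace ExtTrop

/-- The ghost map `ν`. -/
def nu : ExtTrop → ExtTrop
  | negInf => negInf
  | real a => ghost a
  | ghost a => ghost a

/-- The strict total order `≺`: `-∞` is the least element, elements with different underlying
real numbers are compared through these numbers, and `a ≺ a^ν`. -/
def Prec : ExtTrop → ExtTrop → Prop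
  | negInf, negInf => False
  | negInf, real _ => True
  | negInf, ghost _ => True
  | real _, negInf => False
  | ghost _, negInf => False
  | real a, real b => a < b
  | real a, ghost b => a ≤ b
  | ghost a, real b => a < b
  | ghost a, ghost b => a < b

open scoped Classical in
/-- Addition: the `≺`-maximum of two different elements, and `x ⊕ x = x^ν`. -/
protected def add (x y : ExtTrop) : ExtTrop :=
  if x = y then nu x else if Prec x y then y else x

/-- Multiplication: addition of the underlying real numbers; a product with a ghost factor is
ghost, and `-∞` is absorbing. -/
protected def mul : ExtTrop → ExtTrop → ExtTrop
  | real a, real b => real (a + b)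
  | real a, ghost b => ghost (a + b)
  | ghost a, real b => ghost (a + b)
  | ghost a, ghost b => ghost (a + b)
  | negInf, _ => negInf
  | _, negInf => negInf

instance : Zero ExtTrop := ⟨negInf⟩
instance : One ExtTrop := ⟨real 0⟩
instance : Add ExtTrop := ⟨ExtTrop.add⟩
instance : Mul ExtTrop := ⟨ExtTrop.mul⟩

theorem zero_def : (0 : ExtTrop) = negInf := rfl
theorem one_def : (1 : ExtTrop) = real 0 := rfl
theorem add_def (x y : ExtTrop) : x + y = ExtTrop.add x y := rfl
theorem mul_def (x y : ExtTrop) : x * y = ExtTrop.mul x y := rfl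

protected theorem zero_add' (x : ExtTrop) : 0 + x = x := by
  cases x <;> simp [zero_def, add_def, ExtTrop.add, nu, Prec]

protected theorem add_comm' (x y : ExtTrop) : x + y = y + x := by
  cases x <;> cases y <;> simp only [add_def, ExtTrop.add, nu, Prec] <;> grind

protected theorem add_assoc' (x y z : ExtTrop) : x + y + z = x + (y + z) := by
  cases x <;> cases y <;> cases z <;> simp only [add_def, ExtTrop.add] <;> grind [nu, Prec]

protected theorem mul_comm' (x y : ExtTrop) : x * y = y * x := by
  cases x <;> cases y <;> simp [mul_def, ExtTrop.mul, _root_.add_comm]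

protected theorem mul_assoc' (x y z : ExtTrop) : x * y * z = x * (y * z) := by
  cases x <;> cases y <;> cases z <;> simp [mul_def, ExtTrop.mul, _root_.add_assoc]

protected theorem one_mul' (x : ExtTrop) : 1 * x = x := by
  cases x <;> simp [one_def, mul_def, ExtTrop.mul]

protected theorem zero_mul' (x : ExtTrop) : 0 * x = 0 := by
  cases x <;> simp [zero_def, mul_def, ExtTrop.mul]

protected theorem mul_add' (x y z : ExtTrop) : x * (y + z) = x * y + x * z := by
  cases x <;> cases y <;> cases z <;>
    simp only [add_def, mul_def, ExtTrop.add, ExtTrop.mul] <;> grind [nu, Prec, ExtTrop.mul]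

/-- The extended tropical semiring `(𝕋, ⊕, ⊙)`, with zero element `-∞` and unit element the
real element `0`. -/
instance : CommSemiring ExtTrop where
  add_assoc := ExtTrop.add_assoc'
  zero_add := ExtTrop.zero_add'
  add_zero x := by rw [ExtTrop.add_comm', ExtTrop.zero_add']
  add_comm := ExtTrop.add_comm'
  nsmul := nsmulRec
  mul_assoc := ExtTrop.mul_assoc'
  mul_comm := ExtTrop.mul_comm'
  one_mul := ExtTrop.one_mul'
  mul_one x := by rw [ExtTrop.mul_comm', ExtTrop.one_mul']
  zero_mul := ExtTrop.zero_mul'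
  mul_zero x := by rw [ExtTrop.mul_comm', ExtTrop.zero_mul']
  left_distrib := ExtTrop.mul_add'
  right_distrib x y z := by
    rw [ExtTrop.mul_comm', ExtTrop.mul_add', ExtTrop.mul_comm' z x, ExtTrop.mul_comm' z y]

/-- The ghost ideal: the ghost elements together with `-∞`. -/
def ghostIdeal : Set ExtTrop := {x | x = negInf ∨ ∃ a : ℝ, x = ghost a}

/-- The real part `ℝ` of the semiring. -/
def realPart : Set ExtTrop := {x | ∃ a : ℝ, x = real a}

/-- The real part enlarged by `-∞`. -/
def realPartBar : Set ExtTrop := {x | x = negInf ∨ ∃ a : ℝ, x = real a}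

/-- The tropical determinant `|A| = ⨁_σ a_{1,σ(1)} ⋯ a_{n,σ(n)}`. -/
def tropDet {n : ℕ} (A : Matrix (Fin n) (Fin n) ExtTrop) : ExtTrop :=
  ∑ σ : Equiv.Perm (Fin n), ∏ i, A i (σ i)

/-- A square matrix is (tropically) singular if its tropical determinant is ghost or `-∞`. -/
def IsSingular {n : ℕ} (A : Matrix (Fin n) (Fin n) ExtTrop) : Prop :=
  tropDet A ∈ ghostIdeal

/-- The zero set of a polynomial over the extended tropical semiring. -/
def zeroSet {n : ℕ} (f : MvPolynomial (Fin n) ExtTrop) : Set (Fin n → ExtTrop) :=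
  {x | MvPolynomial.eval x f ∈ ghostIdeal}

/-- A system of homogeneous linear equations: all monomials that occur in it have degree one. -/
def IsHomogeneousLinearSystem {m n : ℕ} (S : Fin m → MvPolynomial (Fin n) ExtTrop) : Prop :=
  ∀ i, (S i).IsHomogeneous 1

/-- The coefficient matrix of a linear system: its `(i, j)` entry is the coefficient of the
`j`-th indeterminate in the `i`-th polynomial. -/
def coeffMatrix {m n : ℕ} (S : Fin m → MvPolynomial (Fin n) ExtTrop) :
    Matrix (Fin m) (Fin n) ExtTrop :=
  Matrix.of fun i j => MvPolynomial.coeff (Finsupp.single j 1) (S i)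

/-- A solution of a system is a common zero of its polynomials. -/
def IsSolution {m n : ℕ} (S : Fin m → MvPolynomial (Fin n) ExtTrop) (x : Fin n → ExtTrop) :
    Prop :=
  ∀ i, x ∈ zeroSet (S i)

/-- The system has a pure real solution: one in `ℝ^n`. -/
def HasPureRealSolution {m n : ℕ} (S : Fin m → MvPolynomial (Fin n) ExtTrop) : Prop :=
  ∃ x : Fin n → ExtTrop, IsSolution S x ∧ ∀ j, x j ∈ realPart

/-- The system has a solution in `(ℝ ∪ {-∞})^n` that is not identically `-∞`. -/
def HasNontrivialRealSolution {m n : ℕ} (S : Fin m → MvPolynomial (Fin n) ExtTrop) : Prop :=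
  ∃ x : Fin n → ExtTrop, IsSolution S x ∧ (∀ j, x j ∈ realPartBar) ∧ ∃ j, x j ≠ negInf

end ExtTrop

end

namespace ExtTrop

open Finset Function

/-! Everything is read off from values in max-plus arithmetic: a sum fails to be ghost or `-∞`
exactly when one real term strictly dominates all others (`sum_notMem_ghostIdeal`).

If `A` is nonsingular, a single permutation `σ` strictly dominates. A solution forces a rival for
the `σ`-term of each row with a finite unknown; following the rivals closes a cycle, and rerouting
`σ` along it loses no weight, a contradiction (`isSingular_of_solution`).

Conversely, the solutions are vectors of minors along a row `c`, as in Cramer's rule. They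
annihilate the other rows because a matrix with a repeated row is singular, and row `c` itself if
`c` is well chosen (`exists_solution_of_weight_ne_bot`). When every term of the determinant is `-∞`,
a maximum matching supplies the matrix whose minors are taken (`exists_solution_of_weight_eq_bot`).
With finite coefficients, coordinates `-∞` can be raised to a very low real number
(`exists_real_solution`). -/

/-- The underlying value of an element, forgetting whether it is ghost. -/
def val : ExtTrop → WithBot ℝ
  | negInf => ⊥
  | real a => (a : WithBot ℝ)
  | ghost a => (a : WithBot ℝ)

/-- The non-ghost element with a given value. -/
def ofVal : WithBot ℝ → ExtTrop
  | ⊥ => negInf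
  | (a : ℝ) => real a

@[simp] theorem val_negInf : val negInf = ⊥ := rfl
@[simp] theorem val_real (a : ℝ) : val (real a) = a := rfl
@[simp] theorem val_ghost (a : ℝ) : val (ghost a) = a := rfl
@[simp] theorem val_zero : val 0 = ⊥ := rfl
@[simp] theorem val_one : val 1 = 0 := rfl

@[simp] theorem val_ofVal (v : WithBot ℝ) : val (ofVal v) = v := by
  cases v <;> rfl

theorem ofVal_mem_realPartBar (v : WithBot ℝ) : ofVal v ∈ realPartBar := by
  cases v with
  | bot => exact Or.inl rfl
  | coe a => exact Or.inr ⟨a, rfl⟩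

theorem val_eq_bot {x : ExtTrop} : val x = ⊥ ↔ x = negInf := by
  cases x <;> simp

theorem notMem_ghostIdeal {x : ExtTrop} : x ∉ ghostIdeal ↔ ∃ a, x = real a := by
  cases x <;> simp [ghostIdeal]

theorem zero_mem_ghostIdeal : (0 : ExtTrop) ∈ ghostIdeal := Or.inl rfl

theorem val_ne_bot_of_notMem {x : ExtTrop} (h : x ∉ ghostIdeal) : val x ≠ ⊥ := by
  obtain ⟨a, rfl⟩ := notMem_ghostIdeal.1 h
  simp

theorem val_mul (x y : ExtTrop) : val (x * y) = val x + val y := by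
  cases x <;> cases y <;> simp [mul_def, ExtTrop.mul]

theorem val_add (x y : ExtTrop) : val (x + y) = max (val x) (val y) := by
  cases x <;> cases y <;> simp only [add_def, ExtTrop.add, nu, Prec] <;> split_ifs <;>
    simp_all [le_of_lt] <;> split_ifs <;> grind [val_real, val_ghost]

theorem mul_notMem_ghostIdeal {x y : ExtTrop} :
    x * y ∉ ghostIdeal ↔ x ∉ ghostIdeal ∧ y ∉ ghostIdeal := by
  cases x <;> cases y <;> simp [mul_def, ExtTrop.mul, ghostIdeal]

theorem add_notMem_ghostIdeal {x y : ExtTrop} :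
    x + y ∉ ghostIdeal ↔
      (x ∉ ghostIdeal ∧ val y < val x) ∨ (y ∉ ghostIdeal ∧ val x < val y) := by
  cases x <;> cases y <;> simp only [add_def, ExtTrop.add, nu, Prec] <;> split_ifs <;>
    simp_all [ghostIdeal] <;> grind

/-! ### Values and dominant terms of finite sums and products -/

section Sums

variable {ι : Type*}

theorem val_prod (s : Finset ι) (f : ι → ExtTrop) : val (∏ i ∈ s, f i) = ∑ i ∈ s, val (f i) := by
  classical
  induction s using Finset.induction_on with
  | empty => simp
  | insert a s ha ih => rw [prod_insert ha, sum_insert ha, val_mul, ih]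

theorem prod_notMem_ghostIdeal {s : Finset ι} {f : ι → ExtTrop} :
    ∏ i ∈ s, f i ∉ ghostIdeal ↔ ∀ i ∈ s, f i ∉ ghostIdeal := by
  classical
  induction s using Finset.induction_on with
  | empty => simp [notMem_ghostIdeal, one_def]
  | insert a s ha ih => rw [prod_insert ha, mul_notMem_ghostIdeal, ih, forall_mem_insert]

theorem val_sum_lt {s : Finset ι} {f : ι → ExtTrop} {v : WithBot ℝ} (hv : v ≠ ⊥) :
    val (∑ i ∈ s, f i) < v ↔ ∀ i ∈ s, val (f i) < v := by
  classical
  induction s using Finset.induction_on with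
  | empty => simpa using bot_lt_iff_ne_bot.2 hv
  | insert a s ha ih => rw [sum_insert ha, val_add, max_lt_iff, ih, forall_mem_insert]

/-- A sum is real exactly when its maximal value is attained once, by a real term. -/
theorem sum_notMem_ghostIdeal {s : Finset ι} {f : ι → ExtTrop} :
    ∑ i ∈ s, f i ∉ ghostIdeal ↔
      ∃ i ∈ s, f i ∉ ghostIdeal ∧ ∀ j ∈ s, j ≠ i → val (f j) < val (f i) := by
  classical
  induction s using Finset.induction_on with
  | empty => simp [zero_mem_ghostIdeal]
  | insert a s ha ih =>
    rw [sum_insert ha, add_notMem_ghostIdeal, ih]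
    constructor
    · rintro (⟨h, hlt⟩ | ⟨⟨i, hi, hig, him⟩, hlt⟩)
      · rw [val_sum_lt (val_ne_bot_of_notMem h)] at hlt
        refine ⟨a, mem_insert_self _ _, h, fun j hj hja => hlt j ?_⟩
        exact (mem_insert.1 hj).resolve_left hja
      · refine ⟨i, mem_insert_of_mem hi, hig, fun j hj hji => ?_⟩
        rcases mem_insert.1 hj with rfl | hj
        · refine lt_of_lt_of_le hlt (le_of_not_gt fun hgt => ?_)
          have := (val_sum_lt (s := s) (f := f)
            (ne_bot_of_gt hlt)).not.1 (lt_irrefl _)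
          push Not at this
          obtain ⟨k, hk, hk'⟩ := this
          by_cases hki : k = i
          · subst hki; exact absurd hgt (not_lt.2 hk')
          · exact absurd ((him k hk hki).trans hgt) (not_lt.2 hk')
        · exact him j hj hji
    · rintro ⟨i, hi, hig, him⟩
      rcases mem_insert.1 hi with rfl | hi
      · refine Or.inl ⟨hig, (val_sum_lt (val_ne_bot_of_notMem hig)).2 fun j hj => ?_⟩
        exact him j (mem_insert_of_mem hj) (by rintro rfl; exact ha hj)
      · refine Or.inr ⟨⟨i, hi, hig, fun j hj => him j (mem_insert_of_mem hj)⟩, ?_⟩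
        refine (him a (mem_insert_self _ _) (by rintro rfl; exact ha hi)).trans_le ?_
        refine le_of_not_gt fun hgt => ?_
        exact lt_irrefl _ ((val_sum_lt (val_ne_bot_of_notMem hig)).1 hgt i hi)

end Sums

theorem sum_ne_bot {ι : Type*} {s : Finset ι} {f : ι → WithBot ℝ} :
    ∑ i ∈ s, f i ≠ ⊥ ↔ ∀ i ∈ s, f i ≠ ⊥ := by
  classical
  induction s using Finset.induction_on with
  | empty => simp
  | insert a s ha ih => rw [sum_insert ha, Ne, WithBot.add_eq_bot, not_or, forall_mem_insert,
      ← ih]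

/-- A self-map of a finite type can be made into a permutation by restricting it to its periodic
points. -/
theorem exists_perm_of_selfMap {α : Type*} [Finite α] (φ : α → α) (a : α) :
    ∃ τ : Equiv.Perm α, (∀ k, τ k = φ k ∨ τ k = k) ∧ ∃ m, τ (φ^[m] a) = φ (φ^[m] a) := by
  classical
  have hb := bijOn_periodicPts φ
  let t : α → α := fun k => if k ∈ periodicPts φ then φ k else k
  have ht : Injective t := by
    intro k l hkl
    by_cases hk : k ∈ periodicPts φ <;> by_cases hl : l ∈ periodicPts φ <;>
      simp only [t, hk, hl, if_true, if_false] at hkl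
    · exact hb.injOn hk hl hkl
    · exact absurd (hkl ▸ hb.mapsTo hk) hl
    · exact absurd (hkl ▸ hb.mapsTo hl) hk
    · exact hkl
  refine ⟨Equiv.ofBijective t (Finite.injective_iff_bijective.1 ht), fun k => ?_, ?_⟩
  · by_cases hk : k ∈ periodicPts φ
    · left; simp [t, hk]
    · right; simp [t, hk]
  -- By pigeonhole the orbit of `a` repeats, so it reaches a periodic point.
  · obtain ⟨p, q, hpq, hne⟩ : ∃ p q, φ^[p] a = φ^[q] a ∧ p < q := by
      obtain ⟨p, q, hne, h⟩ := Finite.exists_ne_map_eq_of_infinite fun m : ℕ => φ^[m] a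
      rcases lt_or_gt_of_ne hne with h' | h'
      · exact ⟨p, q, h, h'⟩
      · exact ⟨q, p, h.symm, h'⟩
    refine ⟨p, ?_⟩
    have : φ^[p] a ∈ periodicPts φ := by
      refine mk_mem_periodicPts (Nat.sub_pos_of_lt hne) ?_
      rw [IsPeriodicPt, IsFixedPt, ← iterate_add_apply, Nat.sub_add_cancel hne.le, hpq]
    simp [t, this]

/-! ### A nontrivial solution forces singularity -/

variable {n : ℕ}

/-- The value of the term of the tropical determinant given by a permutation. -/
def weight (A : Matrix (Fin n) (Fin n) ExtTrop) (π : Equiv.Perm (Fin n)) : WithBot ℝ :=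
  ∑ i, val (A i (π i))

theorem not_isSingular_iff {A : Matrix (Fin n) (Fin n) ExtTrop} :
    ¬ IsSingular A ↔ ∃ σ : Equiv.Perm (Fin n), (∀ i, A i (σ i) ∉ ghostIdeal) ∧
      ∀ π, π ≠ σ → weight A π < weight A σ := by
  simp only [IsSingular, tropDet, sum_notMem_ghostIdeal, prod_notMem_ghostIdeal, val_prod,
    mem_univ, true_and, true_imp_iff, weight]

theorem isSingular_of_solution {A : Matrix (Fin n) (Fin n) ExtTrop} {x : Fin n → ExtTrop}
    (hx : ∀ i, ∑ j, A i j * x j ∈ ghostIdeal) (hxr : ∀ j, x j ∈ realPartBar) {a : Fin n}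
    (ha : x a ≠ negInf) : IsSingular A := by
  classical
  by_contra hA
  obtain ⟨σ, hσ, hmax⟩ := not_isSingular_iff.1 hA
  -- Row `σ.symm k` has a real term at `k`, which cannot strictly dominate, so another column `l`
  -- matches it. Where `x k` is `-∞` the map is made to fix `k`.
  have key : ∀ k, ∃ l, (x k = negInf → l = k) ∧ (x k ≠ negInf → l ≠ k ∧ x l ≠ negInf ∧
      val (A (σ.symm k) k) + val (x k) ≤ val (A (σ.symm k) l) + val (x l)) := by
    intro k
    by_cases hk : x k = negInf
    · exact ⟨k, fun _ => rfl, fun h => absurd hk h⟩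
    have h := hx (σ.symm k)
    rw [← not_not (a := _ ∈ _), sum_notMem_ghostIdeal] at h
    push Not at h
    have hAk : A (σ.symm k) k ∉ ghostIdeal := by simpa using hσ (σ.symm k)
    have hxk : x k ∉ ghostIdeal := notMem_ghostIdeal.2 ((hxr k).resolve_left hk)
    obtain ⟨l, -, hlk, hle⟩ := h k (mem_univ _) (mul_notMem_ghostIdeal.2 ⟨hAk, hxk⟩)
    rw [val_mul, val_mul] at hle
    refine ⟨l, fun h => absurd h hk, fun _ => ⟨hlk, fun hl => ?_, hle⟩⟩
    rw [hl, val_negInf, WithBot.add_bot, le_bot_iff, WithBot.add_eq_bot] at hle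
    exact hle.elim (val_ne_bot_of_notMem hAk) (val_ne_bot_of_notMem hxk)
  choose φ hφ0 hφ using key
  obtain ⟨τ, hτ, m, hm⟩ := exists_perm_of_selfMap φ a
  have hsupp : ∀ m, x (φ^[m] a) ≠ negInf := by
    intro m
    induction m with
    | zero => exact ha
    | succ m ih => rw [iterate_succ_apply']; exact (hφ _ ih).2.1
  have hne : σ.trans τ ≠ σ := by
    intro h
    have := Equiv.congr_fun h (σ.symm (φ^[m] a))
    simp only [Equiv.trans_apply, Equiv.apply_symm_apply] at this
    exact (hφ _ (hsupp m)).1 (hm.symm.trans this)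
  refine absurd (hmax _ hne) (not_lt.2 ?_)
  -- The default 0 is arbitrary: it only has to be finite, so that the total of `y` can be
  -- cancelled.
  let y : Fin n → ℝ := fun k => (val (x k)).unbotD 0
  have hy : ∀ k, x k ≠ negInf → (y k : WithBot ℝ) = val (x k) := by
    intro k hk
    have := val_eq_bot.not.2 hk
    obtain ⟨b, hb⟩ := WithBot.ne_bot_iff_exists.1 this
    simp [y, ← hb]
  have hle : ∀ k, val (A (σ.symm k) k) + (y k : WithBot ℝ) ≤
      val (A (σ.symm k) (τ k)) + (y (τ k) : WithBot ℝ) := by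
    intro k
    rcases hτ k with h | h
    · by_cases hk : x k = negInf
      · rw [h, hφ0 k hk]
      · rw [h, hy k hk, hy _ (hφ k hk).2.1]
        exact (hφ k hk).2.2
    · rw [h]
  -- `τ` permutes the unknowns, so both sides contain the same total of `y`; what remains compares
  -- two weights.
  have hsum := sum_le_sum fun k (_ : k ∈ univ) => hle k
  rw [sum_add_distrib, sum_add_distrib, Equiv.sum_comp τ fun k => (y k : WithBot ℝ),
    ← WithBot.coe_sum, WithBot.add_le_add_iff_right WithBot.coe_ne_bot,
    ← Equiv.sum_comp σ, ← Equiv.sum_comp σ fun k => val (A (σ.symm k) (τ k))] at hsum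
  simpa [weight] using hsum

/-! ### Solutions from tropical minors -/

/-- The value of the minor of `B` obtained by deleting row `c` and column `j`. -/
def minorVal (B : Matrix (Fin n) (Fin n) ExtTrop) (c j : Fin n) : WithBot ℝ :=
  (univ.filter fun π : Equiv.Perm (Fin n) => π c = j).sup
    fun π => ∑ i ∈ univ.erase c, val (B i (π i))

theorem le_minorVal (B : Matrix (Fin n) (Fin n) ExtTrop) (c : Fin n) (π : Equiv.Perm (Fin n)) :
    ∑ i ∈ univ.erase c, val (B i (π i)) ≤ minorVal B c (π c) :=
  Finset.le_sup (f := fun π : Equiv.Perm (Fin n) => ∑ i ∈ univ.erase c, val (B i (π i)))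
    (by simp)

theorem exists_minorVal_eq {B : Matrix (Fin n) (Fin n) ExtTrop} {c j : Fin n}
    (h : minorVal B c j ≠ ⊥) : ∃ π : Equiv.Perm (Fin n), π c = j ∧
      ∑ i ∈ univ.erase c, val (B i (π i)) = minorVal B c j := by
  have hne : (univ.filter fun π : Equiv.Perm (Fin n) => π c = j).Nonempty := by
    by_contra hne
    rw [not_nonempty_iff_eq_empty] at hne
    exact h (by rw [minorVal, hne, sup_empty])
  obtain ⟨π, hπ, h⟩ := exists_mem_eq_sup _ hne
    fun π : Equiv.Perm (Fin n) => ∑ i ∈ univ.erase c, val (B i (π i))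
  exact ⟨π, by simpa using hπ, h.symm⟩

theorem weight_updateRow (B : Matrix (Fin n) (Fin n) ExtTrop) (c : Fin n) (r : Fin n → ExtTrop)
    (π : Equiv.Perm (Fin n)) : weight (B.updateRow c r) π =
      val (r (π c)) + ∑ i ∈ univ.erase c, val (B i (π i)) := by
  rw [weight, ← add_sum_erase _ _ (mem_univ c), Matrix.updateRow_self]
  congr 1
  refine sum_congr rfl fun i hi => ?_
  rw [Matrix.updateRow_ne (ne_of_mem_erase hi)]

/-- Laplace expansion along row `c`: the minors of `B` annihilate a row `r` as soon as the maximal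
terms of the determinant with `r` in place of row `c` do not single out a real entry of `r`. -/
theorem sum_mul_minorVal_mem_ghostIdeal {B : Matrix (Fin n) (Fin n) ExtTrop} {c : Fin n}
    {r : Fin n → ExtTrop}
    (H : ∀ π, r (π c) ∉ ghostIdeal → weight (B.updateRow c r) π ≠ ⊥ →
      (∀ π', weight (B.updateRow c r) π' ≤ weight (B.updateRow c r) π) →
      ∃ π', π' c ≠ π c ∧ weight (B.updateRow c r) π ≤ weight (B.updateRow c r) π') :
    ∑ j, r j * ofVal (minorVal B c j) ∈ ghostIdeal := by
  by_contra hcon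
  obtain ⟨j, -, hj, hmax⟩ := sum_notMem_ghostIdeal.1 hcon
  obtain ⟨hr, hm⟩ := mul_notMem_ghostIdeal.1 hj
  have hm' := val_ne_bot_of_notMem hm
  rw [val_ofVal] at hm'
  -- A `π` attaining the minor turns the dominant summand into the weight of `π`.
  obtain ⟨π, rfl, hπ⟩ := exists_minorVal_eq hm'
  have hlt : ∀ π' : Equiv.Perm (Fin n), π' c ≠ π c →
      weight (B.updateRow c r) π' < weight (B.updateRow c r) π := by
    intro π' h
    have := hmax (π' c) (mem_univ _) h
    rw [val_mul, val_mul, val_ofVal, val_ofVal, ← hπ] at this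
    rw [weight_updateRow, weight_updateRow]
    exact (add_le_add_right (le_minorVal B c π') _).trans_lt this
  obtain ⟨π', hne, hle⟩ := H π hr
    (by rw [weight_updateRow, hπ, Ne, WithBot.add_eq_bot, not_or]
        exact ⟨val_ne_bot_of_notMem hr, hm'⟩)
    (fun π' => by
      by_cases h : π' c = π c
      · rw [weight_updateRow, weight_updateRow, h, hπ, ← h]
        exact add_le_add_right (le_minorVal B c π') _
      · exact (hlt π' h).le)
  exact absurd (hlt π' hne) (not_lt.2 hle)

/-- The minors along row `c` annihilate every other row. -/
theorem sum_mul_minorVal_mem_ghostIdeal_of_ne (B : Matrix (Fin n) (Fin n) ExtTrop) {c i : Fin n}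
    (hi : i ≠ c) : ∑ j, B i j * ofVal (minorVal B c j) ∈ ghostIdeal := by
  -- Rows `c` and `i` now agree, so exchanging them preserves the weight and moves the column used
  -- in row `c`.
  refine sum_mul_minorVal_mem_ghostIdeal fun π _ _ _ =>
    ⟨(Equiv.swap c i).trans π, by simpa using hi, le_of_eq ?_⟩
  rw [weight, weight, ← Equiv.sum_comp (Equiv.swap c i)]
  refine sum_congr rfl fun k _ => ?_
  have : (B.updateRow c (B i)) (Equiv.swap c i k) = (B.updateRow c (B i)) k := by
    by_cases hkc : k = c
    · subst hkc; simp [Matrix.updateRow_ne hi]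
    · by_cases hki : k = i
      · subst hki; simp [Matrix.updateRow_ne hi]
      · rw [Equiv.swap_apply_of_ne_of_ne hkc hki]
  rw [this]; rfl

theorem exists_solution_of_weight_ne_bot {A : Matrix (Fin n) (Fin n) ExtTrop}
    (hA : IsSingular A) {ρ : Equiv.Perm (Fin n)} (hρ : weight A ρ ≠ ⊥) :
    ∃ c, (∀ i, ∑ j, A i j * ofVal (minorVal A c j) ∈ ghostIdeal) ∧
      ∃ j, minorVal A c j ≠ ⊥ := by
  obtain ⟨σ, -, hσ⟩ := exists_max_image univ (weight A) ⟨ρ, mem_univ _⟩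
  have hσb : weight A σ ≠ ⊥ := ne_bot_of_le_ne_bot hρ (hσ ρ (mem_univ _))
  -- Take a row where `σ` uses a non-real entry, or else one where two maximal permutations differ:
  -- in either case some maximal permutation avoids the column `π c`.
  obtain ⟨c, hc⟩ : ∃ c, ∀ π : Equiv.Perm (Fin n), A c (π c) ∉ ghostIdeal →
      ∃ π', π' c ≠ π c ∧ weight A σ ≤ weight A π' := by
    by_cases hg : ∃ c, A c (σ c) ∈ ghostIdeal
    · obtain ⟨c, hc⟩ := hg
      exact ⟨c, fun π hπ => ⟨σ, fun h => hπ (h ▸ hc), le_rfl⟩⟩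
    · push Not at hg
      obtain ⟨σ', hne, hle⟩ : ∃ σ', σ' ≠ σ ∧ weight A σ ≤ weight A σ' := by
        by_contra! h
        exact not_isSingular_iff.2 ⟨σ, hg, h⟩ hA
      obtain ⟨c, hc⟩ : ∃ c, σ' c ≠ σ c := by
        by_contra! h
        exact hne (Equiv.ext h)
      refine ⟨c, fun π _ => ?_⟩
      by_cases h : σ c = π c
      · exact ⟨σ', h ▸ hc, hle⟩
      · exact ⟨σ, h, le_rfl⟩
  refine ⟨c, fun i => ?_, σ c, ?_⟩
  · by_cases hi : i = c
    · subst hi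
      refine sum_mul_minorVal_mem_ghostIdeal fun π hπ _ _ => ?_
      have hself : A.updateRow i (A i) = A := Matrix.updateRow_eq_self A i
      rw [hself]
      obtain ⟨π', hne, hle⟩ := hc π hπ
      exact ⟨π', hne, (hσ π (mem_univ _)).trans hle⟩
    · exact sum_mul_minorVal_mem_ghostIdeal_of_ne A hi
  · refine ne_bot_of_le_ne_bot (sum_ne_bot.2 fun i _ => ?_) (le_minorVal A c σ)
    exact sum_ne_bot.1 hσb i (mem_univ _)

/-- A maximum matching on the finite entries misses some row `c`. Filling the missed rows with unit
rows along the matching keeps a minor finite, and maximality kills the products with the missed rows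
of `A`. -/
theorem exists_solution_of_weight_eq_bot {A : Matrix (Fin n) (Fin n) ExtTrop}
    (hA : ∀ π, weight A π = ⊥) :
    ∃ v : Fin n → WithBot ℝ, (∀ i, ∑ j, A i j * ofVal (v j) ∈ ghostIdeal) ∧ ∃ j, v j ≠ ⊥ := by
  classical
  let F : Equiv.Perm (Fin n) → Finset (Fin n) := fun π =>
    univ.filter fun i => val (A i (π i)) ≠ ⊥
  have hF : ∀ π i, i ∈ F π ↔ val (A i (π i)) ≠ ⊥ := fun π i => by simp [F]
  obtain ⟨σ, -, hσ⟩ := exists_max_image univ (fun π => (F π).card) ⟨1, mem_univ _⟩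
  have hmax : ∀ π c, c ∉ F σ → c ∈ F π → ¬ F σ ⊆ F π := by
    intro π c hc hcπ hsub
    have : (insert c (F σ)).card ≤ (F σ).card :=
      (card_le_card (insert_subset hcπ hsub)).trans (hσ π (mem_univ _))
    rw [card_insert_of_notMem hc] at this
    omega
  obtain ⟨c, hc⟩ : ∃ c, c ∉ F σ := by
    by_contra! h
    exact sum_ne_bot.2 (fun i _ => (hF σ i).1 (h i)) (hA σ)
  let B : Matrix (Fin n) (Fin n) ExtTrop := fun i j =>
    if i ∈ F σ then A i j else if j = σ i then 1 else 0
  have hB1 : ∀ i ∈ F σ, B i = A i := fun i hi => by ext j; simp [B, hi]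
  have hB2 : ∀ i ∉ F σ, ∀ j, val (B i j) ≠ ⊥ → j = σ i := by
    intro i hi j hj
    by_contra h
    simp [B, hi, h] at hj
  refine ⟨minorVal B c, fun i => ?_, σ c, ?_⟩
  · by_cases hi : i ∈ F σ
    · rw [← hB1 i hi]
      exact sum_mul_minorVal_mem_ghostIdeal_of_ne B (by rintro rfl; exact hc hi)
    · refine sum_mul_minorVal_mem_ghostIdeal fun π _ hπ _ => ?_
      exfalso
      rw [weight_updateRow, Ne, WithBot.add_eq_bot, not_or] at hπ
      have hk := sum_ne_bot.1 hπ.2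
      -- Giving column `π c` to row `i` would match `i` in addition to all rows of `F σ`.
      refine hmax ((Equiv.swap c i).trans π) i hi ?_ ?_
      · rw [hF]; simpa using hπ.1
      · intro k hkF
        have hkc : k ≠ c := by rintro rfl; exact hc hkF
        have hki : k ≠ i := by rintro rfl; exact hi hkF
        rw [hF, Equiv.trans_apply, Equiv.swap_apply_of_ne_of_ne hkc hki, ← hB1 k hkF]
        exact hk k (mem_erase.2 ⟨hkc, mem_univ _⟩)
  · refine ne_bot_of_le_ne_bot (sum_ne_bot.2 fun i _ => ?_) (le_minorVal B c σ)
    by_cases hi : i ∈ F σ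
    · rw [hB1 i hi]; exact (hF σ i).1 hi
    · simp [B, hi]

theorem IsSingular.exists_solution {A : Matrix (Fin n) (Fin n) ExtTrop} (hA : IsSingular A) :
    ∃ x : Fin n → ExtTrop, (∀ i, ∑ j, A i j * x j ∈ ghostIdeal) ∧ (∀ j, x j ∈ realPartBar) ∧
      ∃ j, x j ≠ negInf := by
  obtain ⟨v, hv, j, hj⟩ : ∃ v : Fin n → WithBot ℝ,
      (∀ i, ∑ j, A i j * ofVal (v j) ∈ ghostIdeal) ∧ ∃ j, v j ≠ ⊥ := by
    by_cases h : ∀ π, weight A π = ⊥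
    · exact exists_solution_of_weight_eq_bot h
    · push Not at h
      obtain ⟨ρ, hρ⟩ := h
      obtain ⟨c, hc⟩ := exists_solution_of_weight_ne_bot hA hρ
      exact ⟨_, hc⟩
  exact ⟨fun j => ofVal (v j), hv, fun j => ofVal_mem_realPartBar _, j,
    fun h => hj (by simpa using val_eq_bot.2 h)⟩

/-! ### Removing infinite coordinates -/

/-- If no coefficient is `-∞`, the coordinates `-∞` of a nontrivial solution can be replaced by
real numbers. -/
theorem exists_real_solution {A : Matrix (Fin n) (Fin n) ExtTrop} (hA : ∀ i j, A i j ≠ negInf)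
    {x : Fin n → ExtTrop} (hx : ∀ i, ∑ j, A i j * x j ∈ ghostIdeal)
    (hxr : ∀ j, x j ∈ realPartBar) {k : Fin n} (hk : x k ≠ negInf) :
    ∃ y : Fin n → ExtTrop, (∀ i, ∑ j, A i j * y j ∈ ghostIdeal) ∧ ∀ j, y j ∈ realPart := by
  classical
  have hval : ∀ i j, ∃ a : ℝ, (a : WithBot ℝ) = val (A i j) := fun i j =>
    WithBot.ne_bot_iff_exists.1 (val_eq_bot.not.2 (hA i j))
  choose a ha using hval
  obtain ⟨b, hb⟩ := (hxr k).resolve_left hk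
  -- `t` is so low that in each row a term with unknown `t` never exceeds the term at `k`.
  obtain ⟨t, ht⟩ := (Set.finite_range fun p : Fin n × Fin n => a p.1 k + b - a p.1 p.2).bddBelow
  have ht' : ∀ i j, val (A i j) + (t : WithBot ℝ) ≤ val (A i k) + val (x k) := by
    intro i j
    have := ht ⟨(i, j), rfl⟩
    simp only at this
    rw [hb, val_real, ← ha, ← ha, ← WithBot.coe_add, ← WithBot.coe_add, WithBot.coe_le_coe]
    linarith
  let y : Fin n → ExtTrop := fun j => if x j = negInf then real t else x j
  have hy : ∀ j, x j ≠ negInf → y j = x j := fun j hj => by simp [y, hj]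
  refine ⟨y, fun i => ?_, fun j => ?_⟩
  · by_contra hcon
    obtain ⟨j, -, hj, hmax⟩ := sum_notMem_ghostIdeal.1 hcon
    by_cases hxj : x j = negInf
    · have hkj : k ≠ j := by rintro rfl; exact hk hxj
      have := hmax k (mem_univ _) hkj
      rw [val_mul, val_mul, hy k hk] at this
      simp only [y, hxj, if_true, val_real] at this
      exact absurd this (not_lt.2 (ht' i j))
    · rw [hy j hxj] at hj hmax
      refine sum_notMem_ghostIdeal.2 ⟨j, mem_univ _, hj, fun l _ hlj => ?_⟩ (hx i)
      by_cases hxl : x l = negInf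
      · rw [val_mul, hxl, val_negInf, WithBot.add_bot]
        exact bot_lt_iff_ne_bot.2 (val_ne_bot_of_notMem hj)
      · rw [← hy l hxl]; exact hmax l (mem_univ _) hlj
  · by_cases hxj : x j = negInf
    · exact ⟨t, by simp [y, hxj]⟩
    · rw [hy j hxj]; exact (hxr j).resolve_left hxj

/-! ### From polynomials to matrices -/

theorem eval_eq_sum_coeff {f : MvPolynomial (Fin n) ExtTrop} (hf : f.IsHomogeneous 1)
    (x : Fin n → ExtTrop) :
    MvPolynomial.eval x f = ∑ j, MvPolynomial.coeff (Finsupp.single j 1) f * x j := by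
  classical
  have hinj : Injective fun j : Fin n => Finsupp.single j 1 :=
    Finsupp.single_left_injective one_ne_zero
  have hsub : f.support ⊆ univ.image fun j : Fin n => Finsupp.single j 1 := by
    intro d hd
    have hdeg : d ∈ {d : Fin n →₀ ℕ | d.degree = 1} := by
      rw [Set.mem_ofPred_eq, Finsupp.degree_eq_weight_one]
      exact hf (MvPolynomial.mem_support_iff.1 hd)
    rw [← Finsupp.range_single_one] at hdeg
    obtain ⟨j, rfl⟩ := hdeg
    exact mem_image_of_mem _ (mem_univ j)
  rw [MvPolynomial.eval_eq, sum_subset hsub, sum_image fun _ _ _ _ h => hinj h]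
  · refine sum_congr rfl fun j _ => ?_
    rw [Finsupp.support_single _ one_ne_zero]
    simp
  · intro d _ hd
    rw [MvPolynomial.notMem_support_iff.1 hd, zero_mul]

theorem isSolution_iff {m : ℕ} {S : Fin m → MvPolynomial (Fin n) ExtTrop}
    (hS : IsHomogeneousLinearSystem S) {x : Fin n → ExtTrop} :
    IsSolution S x ↔ ∀ i, ∑ j, coeffMatrix S i j * x j ∈ ghostIdeal := by
  refine forall_congr' fun i => ?_
  rw [zeroSet, Set.mem_ofPred_eq, eval_eq_sum_coeff (hS i)]
  rfl

theorem HasPureRealSolution.hasNontrivialRealSolution {m : ℕ} (hn : 1 ≤ n)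
    {S : Fin m → MvPolynomial (Fin n) ExtTrop} (h : HasPureRealSolution S) :
    HasNontrivialRealSolution S := by
  obtain ⟨x, hx, hxr⟩ := h
  refine ⟨x, hx, fun j => Or.inr (hxr j), ⟨0, hn⟩, ?_⟩
  obtain ⟨a, ha⟩ := hxr ⟨0, hn⟩
  simp [ha]

end ExtTrop

theorem mainTheorem12 (n : ℕ) (hn : 1 ≤ n)
    (S : Fin n → MvPolynomial (Fin n) ExtTrop)
    (hS : ExtTrop.IsHomogeneousLinearSystem S) :
    (ExtTrop.HasNontrivialRealSolution S ↔ ExtTrop.IsSingular (ExtTrop.coeffMatrix S)) ∧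
    (ExtTrop.HasPureRealSolution S → ExtTrop.IsSingular (ExtTrop.coeffMatrix S)) ∧
    ((∀ i j, ExtTrop.coeffMatrix S i j ≠ ExtTrop.negInf) →
      (ExtTrop.HasPureRealSolution S ↔ ExtTrop.IsSingular (ExtTrop.coeffMatrix S))) := by
  have h1 : ExtTrop.HasNontrivialRealSolution S →
      ExtTrop.IsSingular (ExtTrop.coeffMatrix S) := by
    rintro ⟨x, hx, hxr, a, ha⟩
    exact ExtTrop.isSingular_of_solution ((ExtTrop.isSolution_iff hS).1 hx) hxr ha
  have h2 : ExtTrop.HasPureRealSolution S → ExtTrop.IsSingular (ExtTrop.coeffMatrix S) :=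
    fun h => h1 (h.hasNontrivialRealSolution hn)
  refine ⟨⟨h1, fun h => ?_⟩, h2, fun hA => ⟨h2, fun h => ?_⟩⟩
  · obtain ⟨x, hx, hx'⟩ := h.exists_solution
    exact ⟨x, (ExtTrop.isSolution_iff hS).2 hx, hx'⟩
  · obtain ⟨x, hx, hxr, k, hk⟩ := h.exists_solution
    obtain ⟨y, hy, hyr⟩ := ExtTrop.exists_real_solution hA hx hxr hk
    exact ⟨y, (ExtTrop.isSolution_iff hS).2 hy, hyr⟩
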